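/- Let $p$ be a prime and $F$ a field containing a primitive $p$-th root of unity. Fix a separable closure $F_s$ of $F$, and form all composita inside it. For a field $K$ with $F\subseteq K\subseteq F_s$ let $K^{(2)}$ be the compositum of all cyclic extensions of $K$ of degree $p$, and let $F^{(3)}$ be the compositum of all cyclic extensions of $F^{(2)}$ of degree $p$ that are Galois over $F$. Put $W_F=\mathrm{Gal}(F^{(3)}/F)$ and $V_F=\mathrm{Gal}({F^{(2)}}^{(2)}/F)$. For a pro-$p$ group $\Gamma$ let $\Phi(\Gamma)=\Gamma^p[\Gamma,\Gamma]$ be its (closed) Frattini subgroup. For a cyclic extension $E/F$ of degree $p$ inside $F_s$, let $G_F=\mathrm{Gal}(F_s/F)$, $G_E=\mathrm{Gal}(F_s/E)$ and $T_{E/F}=G_F/G_E^p[G_E,G_E]$, where $G_E^p[G_E,G_E]$ is the closed subgroup generated by the $p$-th powers and commutators of elements of $G_E$; for $\sigma\in V_F$ let $\sigma_{E/F}\in T_{E/F}$ be its image, that is, the class of any extension of $\sigma$ to $F_s$ (this does not depend on the extension). The following are equivalent: 1. there exists $\sigma\in V_F\setminus\Phi(V_F)$ of order $p$; 2. there exists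 $\sigma\in W_F\setminus\Phi(W_F)$ of order $p$; 3. there exists $\sigma\in V_F\setminus\Phi(V_F)$ such that for each cyclic extension $E/F$ of degree $p$ the image $\sigma_{E/F}\in T_{E/F}$ has order at most $p$; 4. $p=2$ and $F$ is formally real. Moreover, if $\sigma$ is any element as in 1, 2 or 3, then the set of elements of $F$ whose square roots (in ${F^{(2)}}^{(2)}$, respectively $F^{(3)}$) are fixed by $\sigma$ is an ordering of $F$, i.e. the set of non-negative elements for a field ordering of $F$. -/

import Mathlib

open scoped IntermediateField

/-- For a subgroup `Δ` of a topological group, the closed subgroup `Δ^p[Δ,Δ]`: the closure of the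
subgroup generated by the `p`-th powers of elements of `Δ` and the commutators of elements
of `Δ`. -/
def pFrattiniOf {G : Type*} [Group G] [TopologicalSpace G] [IsTopologicalGroup G] (p : ℕ)
    (Δ : Subgroup G) : Subgroup G :=
  (Subgroup.closure
    ({x | ∃ g ∈ Δ, x = g ^ p} ∪ {x | ∃ g ∈ Δ, ∃ h ∈ Δ, x = g * h * g⁻¹ * h⁻¹})).topologicalClosure

/-- The Frattini subgroup `Φ(G) = G^p[G,G]` (a closed subgroup) of a pro-`p` group `G`. -/
def proPFrattini (p : ℕ) (G : Type*) [Group G] [TopologicalSpace G] [IsTopologicalGroup G] :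
    Subgroup G :=
  pFrattiniOf p (⊤ : Subgroup G)

/-- `L / K` is a cyclic (Galois) extension of degree `p`. -/
class IsCyclicOfDegree (p : ℕ) (K L : Type*) [Field K] [Field L] [Algebra K L] : Prop where
  isGalois : IsGalois K L
  isCyclic : IsCyclic Gal(L/K)
  finrank_eq : Module.finrank K L = p

/-- `K^(2)`: the compositum, inside `Ω`, of all cyclic extensions of `K` of degree `p`. -/
def cyclicCompositum (p : ℕ) (K Ω : Type*) [Field K] [Field Ω] [Algebra K Ω] :
    IntermediateField K Ω :=
  ⨆ L : {L : IntermediateField K Ω // IsCyclicOfDegree p K L}, L.1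

/-- `F^(3)`: the compositum of all cyclic extensions of `F^(2)` of degree `p` which are Galois
over `F`. -/
def galoisCyclicCompositum (p : ℕ) (F Ω : Type*) [Field F] [Field Ω] [Algebra F Ω] :
    IntermediateField F Ω :=
  (⨆ L : {L : IntermediateField (cyclicCompositum p F Ω) Ω //
      IsCyclicOfDegree p (cyclicCompositum p F Ω) L ∧ IsGalois F L}, L.1).restrictScalars F

/-- `F^(2)^(2)`: the compositum of all cyclic extensions of `F^(2)` of degree `p`. -/
def doubleCyclicCompositum (p : ℕ) (F Ω : Type*) [Field F] [Field Ω] [Algebra F Ω] :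
    IntermediateField F Ω :=
  (cyclicCompositum p (cyclicCompositum p F Ω) Ω).restrictScalars F

/-- `W_F = Gal(F^(3)/F)`, for the separable closure of `F`. -/
abbrev WGroup (p : ℕ) (F : Type*) [Field F] : Type _ :=
  Gal(galoisCyclicCompositum p F (SeparableClosure F)/F)

/-- `V_F = Gal(F^(2)^(2)/F)`, for the separable closure of `F`. -/
abbrev VGroup (p : ℕ) (F : Type*) [Field F] : Type _ :=
  Gal(doubleCyclicCompositum p F (SeparableClosure F)/F)

/-- The `T`-group `T_{E/F} = G_F / G_E^p[G_E,G_E]`, where `G_F` is the Galois group of the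
separable closure over `F` and `G_E` its subgroup fixing `E`. -/
abbrev TGroup (p : ℕ) {F : Type*} [Field F] (E : IntermediateField F (SeparableClosure F)) :
    Type _ :=
  Gal(SeparableClosure F/F) ⧸ pFrattiniOf p E.fixingSubgroup

theorem pFrattiniOf_mono {G : Type*} [Group G] [TopologicalSpace G] [IsTopologicalGroup G] (p : ℕ)
    {A B : Subgroup G} (h : A ≤ B) : pFrattiniOf p A ≤ pFrattiniOf p B := by
  apply Subgroup.topologicalClosure_mono
  apply Subgroup.closure_mono
  rintro x (⟨g, hg, rfl⟩ | ⟨g, hg, k, hk, rfl⟩)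
  · exact Or.inl ⟨g, h hg, rfl⟩
  · exact Or.inr ⟨g, h hg, k, h hk, rfl⟩

theorem pow_mem_pFrattiniOf {G : Type*} [Group G] [TopologicalSpace G] [IsTopologicalGroup G]
    (p : ℕ) {A : Subgroup G} {g : G} (h : g ∈ A) : g ^ p ∈ pFrattiniOf p A :=
  Subgroup.le_topologicalClosure _ (Subgroup.subset_closure (Or.inl ⟨g, h, rfl⟩))

theorem commutator_mem_pFrattiniOf {G : Type*} [Group G] [TopologicalSpace G]
    [IsTopologicalGroup G] (p : ℕ) {A : Subgroup G} {g k : G} (h : g ∈ A) (hk : k ∈ A) :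
    g * k * g⁻¹ * k⁻¹ ∈ pFrattiniOf p A :=
  Subgroup.le_topologicalClosure _ (Subgroup.subset_closure (Or.inr ⟨g, h, k, hk, rfl⟩))

theorem isClosed_pFrattiniOf {G : Type*} [Group G] [TopologicalSpace G] [IsTopologicalGroup G]
    (p : ℕ) (A : Subgroup G) : IsClosed (pFrattiniOf p A : Set G) :=
  Subgroup.isClosed_topologicalClosure _

instance pFrattiniOf_normal {G : Type*} [Group G] [TopologicalSpace G] [IsTopologicalGroup G]
    (p : ℕ) (A : Subgroup G) [hA : A.Normal] : (pFrattiniOf p A).Normal := by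
  have : (Subgroup.closure
      ({x | ∃ g ∈ A, x = g ^ p} ∪ {x | ∃ g ∈ A, ∃ h ∈ A, x = g * h * g⁻¹ * h⁻¹})).Normal := by
    refine ⟨fun n hn c => ?_⟩
    have hle : Subgroup.closure
        ({x | ∃ g ∈ A, x = g ^ p} ∪ {x | ∃ g ∈ A, ∃ h ∈ A, x = g * h * g⁻¹ * h⁻¹}) ≤
        (Subgroup.closure ({x | ∃ g ∈ A, x = g ^ p} ∪
          {x | ∃ g ∈ A, ∃ h ∈ A, x = g * h * g⁻¹ * h⁻¹})).comap (MulAut.conj c).toMonoidHom := by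
      rw [Subgroup.closure_le]
      rintro x (⟨g, hg, rfl⟩ | ⟨g, hg, k, hk, rfl⟩)
      · refine Subgroup.subset_closure (Or.inl ⟨c * g * c⁻¹, hA.conj_mem g hg c, ?_⟩)
        simp
      · refine Subgroup.subset_closure (Or.inr ⟨c * g * c⁻¹, hA.conj_mem g hg c,
          c * k * c⁻¹, hA.conj_mem k hk c, ?_⟩)
        simp only [MulEquiv.coe_toMonoidHom, MulAut.conj_apply]
        group
    exact hle hn
  exact Subgroup.is_normal_topologicalClosure _

theorem fixingSubgroup_normal_of_isCyclicOfDegree (p : ℕ) {F : Type*} [Field F]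
    (E : IntermediateField F (SeparableClosure F)) [hE : IsCyclicOfDegree p F E] :
    E.fixingSubgroup.Normal := by
  have := hE.isGalois
  infer_instance

noncomputable instance TGroup.instGroup (p : ℕ) {F : Type*} [Field F]
    (E : IntermediateField F (SeparableClosure F)) [IsCyclicOfDegree p F E] :
    Group (TGroup p E) :=
  have := fixingSubgroup_normal_of_isCyclicOfDegree p E
  QuotientGroup.Quotient.group _

/-- An automorphism of `Ω` fixing all cyclic extensions of degree `p` lies in the Frattini
subgroup. -/
theorem mem_proPFrattini_of_fixes {p : ℕ} (hp : p.Prime) {K Ω : Type*} [Field K] [Field Ω]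
    [Algebra K Ω] [IsGalois K Ω] (τ : Gal(Ω/K))
    (hτ : ∀ x ∈ cyclicCompositum p K Ω, τ x = x) : τ ∈ proPFrattini p Gal(Ω/K) := by
  have hN := InfiniteGalois.fixingSubgroup_fixedField (k := K) (K := Ω)
    ⟨proPFrattini p Gal(Ω/K), isClosed_pFrattiniOf p _⟩
  have hnorm : (proPFrattini p Gal(Ω/K)).Normal := pFrattiniOf_normal p ⊤
  simp only at hN
  set M := IntermediateField.fixedField (proPFrattini p Gal(Ω/K)) with hM
  have hMG : IsGalois K M := by
    rw [← InfiniteGalois.normal_iff_isGalois, hN]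
    exact hnorm
  have hfix : ∀ g ∈ proPFrattini p Gal(Ω/K), ∀ x ∈ M, g x = x := fun g hg x hx => hx ⟨g, hg⟩
  have hMA : IsAbelianGalois K M := by
    refine { toIsGalois := hMG, toIsMulCommutative := ⟨⟨fun a b => ?_⟩⟩ }
    obtain ⟨g, rfl⟩ := AlgEquiv.restrictNormalHom_surjective (F := K) (K₁ := M) Ω a
    obtain ⟨h, rfl⟩ := AlgEquiv.restrictNormalHom_surjective (F := K) (K₁ := M) Ω b
    rw [← commutatorElement_eq_one_iff_mul_comm, commutatorElement_def, ← map_inv, ← map_inv,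
      ← map_mul, ← map_mul, ← map_mul]
    ext x
    rw [AlgEquiv.restrictNormalHom_apply]
    exact hfix _ (commutator_mem_pFrattiniOf p (Subgroup.mem_top _) (Subgroup.mem_top _)) _ x.2
  rw [← hN, IntermediateField.mem_fixingSubgroup_iff]
  intro x hx
  set L : IntermediateField K Ω := K⟮x⟯ with hL
  have hLM : L ≤ M := by rw [hL, IntermediateField.adjoin_simple_le_iff]; exact hx
  let : Algebra L M := (IntermediateField.inclusion hLM).toRingHom.toAlgebra
  have : IsScalarTower K L M := IsScalarTower.of_algebraMap_eq' rfl
  have : IsAbelianGalois K L := IsAbelianGalois.tower_bot K L M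
  have : FiniteDimensional K L :=
    IntermediateField.adjoin.finiteDimensional (Algebra.IsIntegral.isIntegral x)
  let : CommGroup Gal(L/K) := { mul_comm := fun a b => mul_comm' a b }
  have hexp : ∀ a : Gal(L/K), a ^ p = 1 := by
    intro a
    obtain ⟨g, rfl⟩ := AlgEquiv.restrictNormalHom_surjective (F := K) (K₁ := L) Ω a
    rw [← map_pow]
    ext y
    rw [AlgEquiv.restrictNormalHom_apply]
    exact hfix _ (pow_mem_pFrattiniOf p (Subgroup.mem_top _)) _ (hLM y.2)
  by_contra hne
  set a : Gal(L/K) := AlgEquiv.restrictNormalHom L τ with ha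
  have ha1 : a ≠ 1 := by
    intro h
    apply hne
    have := AlgEquiv.restrictNormalHom_apply L τ ⟨x, IntermediateField.mem_adjoin_simple_self K x⟩
    rw [← ha, h] at this
    exact this.symm
  have : NeZero (Monoid.exponent Gal(L/K)) := ⟨Monoid.exponent_ne_zero_of_finite⟩
  obtain ⟨φ, hφ⟩ := CommGroup.exists_apply_ne_one_of_hasEnoughRootsOfUnity Gal(L/K) ℂ ha1
  set H := φ.ker with hH
  let e : Gal(L/K) ⧸ H ≃* φ.range := QuotientGroup.quotientKerEquivRange φ
  let D : IntermediateField K L := IntermediateField.fixedField H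
  let D' : IntermediateField K Ω := IntermediateField.lift D
  have : IsGalois K D := inferInstance
  let eD : Gal(L/K) ⧸ H ≃* Gal(D/K) := IsGalois.normalAutEquivQuotient H
  have hcard : Nat.card φ.range = p := by
    have hcyc : IsCyclic φ.range := inferInstance
    rw [← IsCyclic.exponent_eq_card]
    have hdvd : Monoid.exponent φ.range ∣ p := by
      apply Monoid.exponent_dvd_of_forall_pow_eq_one
      rintro ⟨_, b, rfl⟩
      apply Subtype.ext
      change φ b ^ p = 1
      rw [← map_pow, hexp, map_one]
    refine (hp.eq_one_or_self_of_dvd _ hdvd).resolve_left fun h1 => hφ ?_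
    have := Monoid.pow_exponent_eq_one (⟨φ a, a, rfl⟩ : φ.range)
    rw [h1, pow_one] at this
    exact congrArg Subtype.val this
  have hD' : IsCyclicOfDegree p K D' := by
    have hg : IsGalois K D' := IsGalois.of_algEquiv (IntermediateField.liftAlgEquiv D)
    have e' : φ.range ≃* Gal(D'/K) :=
      (e.symm.trans eD).trans (AlgEquiv.autCongr (IntermediateField.liftAlgEquiv D))
    have : Finite φ.range := inferInstance
    refine ⟨hg, ?_, ?_⟩
    · have : IsCyclic φ.range := inferInstance
      exact isCyclic_of_surjective e' e'.surjective
    · have : FiniteDimensional K D' :=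
        (IntermediateField.liftAlgEquiv D).toLinearEquiv.finiteDimensional
      rw [← IsGalois.card_aut_eq_finrank, ← hcard]
      exact (Nat.card_congr e'.toEquiv).symm
  have hDle : D' ≤ cyclicCompositum p K Ω :=
    le_iSup (fun L : {L : IntermediateField K Ω // IsCyclicOfDegree p K L} => L.1) ⟨D', hD'⟩
  have haH : a ∈ H := by
    rw [← IntermediateField.fixingSubgroup_fixedField H, IntermediateField.mem_fixingSubgroup_iff]
    intro y hy
    apply Subtype.ext
    rw [ha, AlgEquiv.restrictNormalHom_apply]
    exact hτ _ (hDle ((IntermediateField.mem_lift y).2 hy))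
  exact hφ haH

/-- Any two automorphisms of the separable closure with the same restriction to `F^(2)^(2)` have
the same class in `T_{E/F}`. -/
theorem TGroup.mk_eq_mk {p : ℕ} (hp : p.Prime) {F : Type*} [Field F]
    (E : IntermediateField F (SeparableClosure F)) [hE : IsCyclicOfDegree p F E]
    (τ₁ τ₂ : Gal(SeparableClosure F/F))
    (h : ∀ x ∈ doubleCyclicCompositum p F (SeparableClosure F), τ₁ x = τ₂ x) :
    (QuotientGroup.mk τ₁ : TGroup p E) = QuotientGroup.mk τ₂ := by
  rw [QuotientGroup.eq]
  set K := cyclicCompositum p F (SeparableClosure F) with hK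
  have hEK : E ≤ K :=
    le_iSup (fun L : {L : IntermediateField F (SeparableClosure F) // IsCyclicOfDegree p F L} =>
      L.1) ⟨E, hE⟩
  apply pFrattiniOf_mono p (IntermediateField.fixingSubgroup_antitone hEK)
  set τ := τ₁⁻¹ * τ₂ with hτ
  have hfix : ∀ x ∈ doubleCyclicCompositum p F (SeparableClosure F), τ x = x := by
    intro x hx
    rw [hτ, AlgEquiv.mul_apply, ← h x hx]
    exact τ₁.symm_apply_apply x
  have hτK : τ ∈ K.fixingSubgroup := by
    rw [IntermediateField.mem_fixingSubgroup_iff]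
    intro x hx
    exact hfix x ((cyclicCompositum p K (SeparableClosure F)).algebraMap_mem ⟨x, hx⟩)
  set τ' : Gal(SeparableClosure F/K) := IntermediateField.fixingSubgroupEquiv K ⟨τ, hτK⟩
  have : IsGalois K (SeparableClosure F) := inferInstance
  have hmem := mem_proPFrattini_of_fixes hp τ' (fun x hx => hfix x hx)
  let r : Gal(SeparableClosure F/K) →* Gal(SeparableClosure F/F) :=
    AlgEquiv.restrictScalarsHom F
  have hr : Continuous r := by
    apply continuous_of_continuousAt_one
    rw [ContinuousAt, map_one]
    intro s hs
    obtain ⟨D, hD, hDs⟩ := (krullTopology_mem_nhds_one_iff F (SeparableClosure F) s).1 hs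
    refine (krullTopology_mem_nhds_one_iff K (SeparableClosure F) _).2
      ⟨IntermediateField.adjoin K (D : Set (SeparableClosure F)), ?_, fun g hg => hDs ?_⟩
    · have : FiniteDimensional F D := hD
      obtain ⟨t, ht⟩ := IntermediateField.essFiniteType_iff.1
        (inferInstance : Algebra.EssFiniteType F D)
      have hle : IntermediateField.adjoin K (D : Set (SeparableClosure F)) ≤
          IntermediateField.adjoin K (t : Set (SeparableClosure F)) := by
        rw [IntermediateField.adjoin_le_iff, ← ht]
        change IntermediateField.adjoin F _ ≤ (IntermediateField.adjoin K _).restrictScalars F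
        rw [IntermediateField.adjoin_le_iff]
        exact IntermediateField.subset_adjoin K _
      have := IntermediateField.finiteDimensional_adjoin (K := K) (S := (t : Set (SeparableClosure F)))
        fun x _ => Algebra.IsIntegral.isIntegral x
      exact Module.Finite.of_injective (IntermediateField.inclusion hle).toLinearMap
        (IntermediateField.inclusion hle).injective
    · intro x
      exact hg ⟨x.1, IntermediateField.subset_adjoin K _ x.2⟩
  have hle : proPFrattini p Gal(SeparableClosure F/K) ≤
      (pFrattiniOf p K.fixingSubgroup).comap r := by
    apply Subgroup.topologicalClosure_minimal
    · rw [Subgroup.closure_le]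
      have hrK : ∀ g, r g ∈ K.fixingSubgroup := fun g => by
        rw [IntermediateField.mem_fixingSubgroup_iff]
        exact fun x hx => g.commutes ⟨x, hx⟩
      rintro x (⟨g, -, rfl⟩ | ⟨g, -, k, -, rfl⟩)
      · simpa using pow_mem_pFrattiniOf p (hrK g)
      · simpa using commutator_mem_pFrattiniOf p (hrK g) (hrK k)
    · exact (isClosed_pFrattiniOf p _).preimage hr
  exact hle hmem

/-- The natural homomorphism `V_F → T_{E/F}`, `σ ↦ σ_{E/F}`: the class of any extension of `σ` to
the separable closure of `F`. -/
noncomputable def VGroup.toT {p : ℕ} (hp : p.Prime) {F : Type*} [Field F]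
    (E : IntermediateField F (SeparableClosure F)) [IsCyclicOfDegree p F E] :
    VGroup p F →* TGroup p E :=
  MonoidHom.mk' (fun σ => QuotientGroup.mk (σ.liftNormal (SeparableClosure F))) (by
    intro σ τ
    have := fixingSubgroup_normal_of_isCyclicOfDegree p E
    refine (TGroup.mk_eq_mk hp E _ (σ.liftNormal (SeparableClosure F) *
      τ.liftNormal (SeparableClosure F)) fun x hx => ?_).trans rfl
    have h1 := (σ * τ).liftNormal_commutes (SeparableClosure F) ⟨x, hx⟩
    have h2 := τ.liftNormal_commutes (SeparableClosure F) ⟨x, hx⟩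
    have h3 := σ.liftNormal_commutes (SeparableClosure F) (τ ⟨x, hx⟩)
    change _ = σ.liftNormal _ (τ.liftNormal _ _)
    exact h1.trans (((congrArg _ h2).trans h3).symm))

theorem VGroup.toT_apply {p : ℕ} (hp : p.Prime) {F : Type*} [Field F]
    (E : IntermediateField F (SeparableClosure F)) [IsCyclicOfDegree p F E] (σ : VGroup p F)
    (τ : Gal(SeparableClosure F/F))
    (h : ∀ x : doubleCyclicCompositum p F (SeparableClosure F), τ x = σ x) :
    VGroup.toT hp E σ = QuotientGroup.mk τ :=
  TGroup.mk_eq_mk hp E _ _ fun x hx =>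
    (σ.liftNormal_commutes (SeparableClosure F) ⟨x, hx⟩).trans (h ⟨x, hx⟩).symm

/-- The subset `P` of the field `F` is (the set of nonnegative elements of) an ordering of `F`. -/
def IsFieldOrdering {F : Type*} [Field F] (P : Set F) : Prop :=
  ∃ O : RingPreordering F, O.IsOrdering ∧ (O : Set F) = P

/-- The elements of `F` whose square roots in `K` are fixed by `σ`. -/
def fixedSquareRoots {F K : Type*} [Field F] [Field K] [Algebra F K] (σ : Gal(K/F)) : Set F :=
  {a | ∀ x : K, x ^ 2 = algebraMap F K a → σ x = x}

/-! Since `F` contains the `p`-th roots of unity, Kummer theory turns every group in the statement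
into data about `p`-th roots: `K^(2)` is generated by the `p`-th roots of elements of `K`, and an
automorphism lies outside the Frattini subgroup exactly when it moves a `p`-th root of an element of
`F` (`notMem_proPFrattini_iff`). All automorphisms are lifted to one field `Ω` and compared there.

From group elements to orderings: let `τ` move `α` with `α ^ p` in `F`, and let `β ^ p = α`.
Iterating `τ` on `β` shows that `τ ^ p` moves `β`, unless `p = 2` and `τ` moves `√-1`
(`pow_apply_ne_of_apply_ne`). So if `τ ^ p` fixes such `β`, then `p = 2` and `-1` is negative for
the sign character recording whether `τ` fixes `√a`. That the positive elements are closed under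
addition comes from the square roots of `1 + s` with `s ^ 2` in `F` (`sq_apply_ne_of_apply_eq_neg`).
Only these two kinds of roots are used. They lie in `F^(3)`, which handles `W_F`, and they are
`p`-th roots of elements of `E = F(α)` or `E = F(s)`, which is what the groups `T_{E/F}` control.

From formal reality to an involution: choose a subfield `K` of `Ω` maximal with `-1` not a sum of
squares. Each element of `K` is a square up to sign, so `K(√-1)` is closed under square roots and
contains `F^(2)^(2)`. An automorphism over `K` moving `√-1` squares to the identity on `K(√-1)`,
hence restricts to an element of order two of `V_F` outside the Frattini subgroup. -/

/-! ### Automorphisms acting on iterated `p`-th roots, and the ordering they define. -/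

/-- A `p`-th root of unity lies in any field containing a primitive one. -/
theorem exists_algebraMap_eq_of_pow_eq_one {F Ω : Type*} [Field F] [Field Ω] [Algebra F Ω] {p : ℕ}
    (hp : p.Prime) {ξ : F} (hξ : IsPrimitiveRoot ξ p) {w : Ω} (hw : w ^ p = 1) :
    ∃ v : F, v ^ p = 1 ∧ algebraMap F Ω v = w := by
  have : NeZero p := ⟨hp.ne_zero⟩
  obtain ⟨i, -, hi⟩ := (hξ.map_of_injective (algebraMap F Ω).injective).eq_pow_of_pow_eq_one hw
  exact ⟨ξ ^ i, by rw [← pow_mul, mul_comm, pow_mul, hξ.pow_eq_one, one_pow], by simpa using hi⟩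

theorem apply_eq_self_of_pow_eq_one {F Ω : Type*} [Field F] [Field Ω] [Algebra F Ω] {p : ℕ}
    (hp : p.Prime) {ξ : F} (hξ : IsPrimitiveRoot ξ p) (τ : Gal(Ω/F)) {w : Ω} (hw : w ^ p = 1) :
    τ w = w := by
  obtain ⟨v, -, rfl⟩ := exists_algebraMap_eq_of_pow_eq_one hp hξ hw
  exact τ.commutes v

/-- If `y ^ p` is fixed, then `τ y` is `y` times a `p`-th root of unity. -/
theorem exists_apply_eq_mul {F Ω : Type*} [Field F] [Field Ω] [Algebra F Ω] {p : ℕ}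
    (τ : Gal(Ω/F)) {y : Ω} (hy : τ (y ^ p) = y ^ p) :
    ∃ w : Ω, w ^ p = 1 ∧ τ y = w * y := by
  rcases eq_or_ne y 0 with rfl | h0
  · exact ⟨1, by simp, by simp⟩
  refine ⟨τ y / y, ?_, (div_mul_cancel₀ _ h0).symm⟩
  rw [div_pow, ← map_pow, hy, div_self (pow_ne_zero p h0)]

/-- `τ` multiplies `y` by a root of unity that lies in `F` and so is itself fixed; hence iterates of
`τ` multiply `y` by its powers. -/
theorem pow_apply_eq_self {F Ω : Type*} [Field F] [Field Ω] [Algebra F Ω] {p : ℕ}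
    (hp : p.Prime) {ξ : F} (hξ : IsPrimitiveRoot ξ p) (τ : Gal(Ω/F)) {y : Ω}
    (hy : τ (y ^ p) = y ^ p) : (τ ^ p) y = y := by
  obtain ⟨w, hw, hτ⟩ := exists_apply_eq_mul τ hy
  have h : ∀ k : ℕ, (τ ^ k) y = w ^ k * y := by
    intro k
    induction k with
    | zero => simp
    | succ k ih =>
      rw [pow_succ', AlgEquiv.mul_apply, ih, map_mul, map_pow,
        apply_eq_self_of_pow_eq_one hp hξ τ hw, hτ]
      ring
  rw [h, hw, one_mul]

/-- An automorphism moving a `p`-th root `α` of an element of `F` has `p`-th power moving the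
`p`-th roots of `α`. -/
theorem pow_apply_ne_of_apply_ne {F Ω : Type*} [Field F] [Field Ω] [Algebra F Ω] {p : ℕ}
    (hp : p.Prime) {ξ : F} (hξ : IsPrimitiveRoot ξ p) (τ : Gal(Ω/F)) {α β : Ω}
    (hα : τ (α ^ p) = α ^ p) (hne : τ α ≠ α) (hβ : β ^ p = α)
    (h : p ≠ 2 ∨ ∀ x : Ω, x ^ 2 = -1 → τ x = x) : (τ ^ p) β ≠ β := by
  have hβ0 : β ≠ 0 := by
    rintro rfl
    apply hne
    rw [← hβ, zero_pow hp.ne_zero, map_zero]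
  obtain ⟨z, hz, hτα⟩ := exists_apply_eq_mul τ hα
  set η := τ β / β with hη
  have hτβ : τ β = η * β := (div_mul_cancel₀ _ hβ0).symm
  have hηz : η ^ p = z := by
    rw [hη, div_pow, ← map_pow, hβ, hτα, mul_div_assoc, div_self, mul_one]
    rw [← hβ]
    exact pow_ne_zero p hβ0
  have hzτ := apply_eq_self_of_pow_eq_one hp hξ τ hz
  obtain ⟨w, hw, hτη⟩ := exists_apply_eq_mul τ (y := η) (by rw [hηz, hzτ])
  -- Each application of `τ` to `η ^ k` contributes a factor `w ^ k`; the exponents `0 + 1 + ... +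
  -- (k - 1)` add up to `k.choose 2`.
  have hk : ∀ k : ℕ, (τ ^ k) β = w ^ k.choose 2 * η ^ k * β := by
    intro k
    induction k with
    | zero => simp
    | succ k ih =>
      rw [pow_succ', AlgEquiv.mul_apply, ih, map_mul, map_mul, map_pow, map_pow,
        apply_eq_self_of_pow_eq_one hp hξ τ hw, hτη, hτβ, Nat.choose_succ_succ' k 1,
        Nat.choose_one_right, mul_pow, pow_add]
      ring
  have hz1 : z ≠ 1 := by
    rintro rfl
    exact hne (by rw [hτα, one_mul])
  -- For odd `p`, `p` divides `p.choose 2`. For `p = 2` the exponent is `1`, but `η` is then a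
  -- square root of `-1`, so it is fixed and `w = 1`.
  have hw1 : w ^ p.choose 2 = 1 := by
    rcases eq_or_ne p 2 with rfl | hp2
    · have hz' : z = -1 := (sq_eq_sq_iff_eq_or_eq_neg.1 (hz.trans (one_pow 2).symm)).resolve_left hz1
      have hη1 : τ η = η := h.resolve_left (fun h => h rfl) η (by rw [hηz, hz'])
      have hη0 : η ≠ 0 := by
        rw [hη]
        exact div_ne_zero ((map_ne_zero τ).2 hβ0) hβ0
      rw [hτη, mul_eq_right₀ hη0] at hη1
      rw [hη1, one_pow]
    · obtain ⟨m, hm⟩ := hp.dvd_choose_self two_ne_zero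
        (lt_of_le_of_ne hp.two_le (Ne.symm hp2))
      rw [hm, pow_mul, hw, one_pow]
  rw [hk, hw1, one_mul, hηz]
  intro h1
  exact hz1 (mul_right_cancel₀ hβ0 (h1.trans (one_mul β).symm))

/-- Automorphisms inverting both `s` and a square root `r` of `1 - s ^ 2` do not have a square
fixing the square roots of `1 + s`. -/
theorem sq_apply_ne_of_apply_eq_neg {F Ω : Type*} [Field F] [Field Ω] [Algebra F Ω]
    (h2 : (2 : Ω) ≠ 0) (τ : Gal(Ω/F)) {s r y : Ω} (hr0 : r ≠ 0) (hs : τ s = -s) (hr : τ r = -r)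
    (hrs : r ^ 2 = 1 - s ^ 2) (hy : y ^ 2 = 1 + s) : (τ ^ 2) y ≠ y := by
  intro h
  have h1 : (τ y) ^ 2 = 1 - s := by
    rw [← map_pow, hy, map_add, map_one, hs]
    ring
  -- If `τ ^ 2` fixed `y`, the norm `y * τ y` would be fixed; but its square is `(1 + s) * (1 - s) =
  -- r ^ 2`, so it is `±r`, which `τ` negates.
  have h3 : τ (y * τ y) = y * τ y := by
    rw [pow_two, AlgEquiv.mul_apply] at h
    rw [map_mul, h, mul_comm]
  have h4 : (y * τ y) ^ 2 = r ^ 2 := by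
    rw [mul_pow, h1, hy, hrs]
    ring
  have h5 : τ r = r := by
    rcases sq_eq_sq_iff_eq_or_eq_neg.1 h4 with h4 | h4
    · rw [← h4, h3]
    · rw [← neg_eq_iff_eq_neg.2 h4, map_neg, h3]
  rw [h5] at hr
  have : 2 * r = 0 := by linear_combination hr
  exact (mul_ne_zero h2 hr0) this

/-- An automorphism whose `p`-th power fixes the relevant `p`-th roots, and which is nontrivial
on the `p`-th roots of elements of `F`, determines an ordering. -/
theorem eq_two_and_isFieldOrdering {F Ω : Type*} [Field F] [Field Ω] [Algebra F Ω] {p : ℕ}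
    (hp : p.Prime) {ξ : F} (hξ : IsPrimitiveRoot ξ p) (τ : Gal(Ω/F))
    (hroot : ∀ x : Ω, ∃ y : Ω, y ^ p = x)
    (hA : ∀ α β : Ω, α ^ p ∈ (algebraMap F Ω).range → τ α ≠ α → β ^ p = α → (τ ^ p) β = β)
    (hB : p = 2 → ∀ s y : Ω, s ^ p ∈ (algebraMap F Ω).range → τ s ≠ s → y ^ p = 1 + s →
      (τ ^ p) y = y)
    (hne : ∃ α : Ω, α ^ p ∈ (algebraMap F Ω).range ∧ τ α ≠ α) :
    p = 2 ∧ IsFieldOrdering (fixedSquareRoots τ) := by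
  obtain ⟨α, hα, hτα⟩ := hne
  have hfix : ∀ x ∈ (algebraMap F Ω).range, τ x = x := by
    rintro _ ⟨a, rfl⟩
    exact τ.commutes a
  obtain ⟨β, hβ⟩ := hroot α
  have key : ¬ (p ≠ 2 ∨ ∀ x : Ω, x ^ 2 = -1 → τ x = x) := fun h =>
    pow_apply_ne_of_apply_ne hp hξ τ (hfix _ hα) hτα hβ h (hA α β hα hτα hβ)
  push Not at key
  obtain ⟨rfl, ι, hι, hτι⟩ := key
  refine ⟨rfl, ?_⟩
  have h2F : (2 : F) ≠ 0 := by
    intro h2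
    have h1 : ξ = -1 := hξ.eq_neg_one_of_two_right
    refine hξ.ne_one one_lt_two (h1.trans ?_)
    linear_combination -h2
  have h2 : (2 : Ω) ≠ 0 := by
    rw [← map_ofNat (algebraMap F Ω)]
    exact (map_ne_zero _).2 h2F
  have hneg : ∀ x : Ω, x ^ 2 ∈ (algebraMap F Ω).range → τ x ≠ x → τ x = -x := by
    intro x hx hne
    refine (sq_eq_sq_iff_eq_or_eq_neg.1 ?_).resolve_left hne
    rw [← map_pow, hfix _ hx]
  set P := fixedSquareRoots τ with hP
  have hmem : ∀ a : F, ∀ x : Ω, x ^ 2 = algebraMap F Ω a → τ x = x → a ∈ P := by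
    intro a x hx hτ y hy
    rcases sq_eq_sq_iff_eq_or_eq_neg.1 (hy.trans hx.symm) with rfl | rfl
    · exact hτ
    · rw [map_neg, hτ]
  have hnot : ∀ a : F, a ∉ P → ∃ x : Ω, x ^ 2 = algebraMap F Ω a ∧ τ x = -x := by
    intro a ha
    obtain ⟨x, hx⟩ := hroot (algebraMap F Ω a)
    refine ⟨x, hx, hneg x ⟨a, hx.symm⟩ fun h => ha (hmem a x hx h)⟩
  have hm1 : (-1 : F) ∉ P := fun h => hτι (h ι (by simpa using hι))
  have hsq : ∀ a : F, a * a ∈ P := fun a =>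
    hmem _ (algebraMap F Ω a) (by rw [map_mul, pow_two]) (τ.commutes a)
  have hmul : ∀ {a b : F}, a ∈ P → b ∈ P → a * b ∈ P := by
    intro a b ha hb
    obtain ⟨u, hu⟩ := hroot (algebraMap F Ω a)
    obtain ⟨v, hv⟩ := hroot (algebraMap F Ω b)
    exact hmem _ (u * v) (by rw [mul_pow, hu, hv, map_mul]) (by rw [map_mul, ha u hu, hb v hv])
  -- With `hmul`, this says that membership in `P` behaves like a sign: two sign changes cancel.
  have hmul' : ∀ {a b : F}, a ∉ P → b ∉ P → a * b ∈ P := by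
    intro a b ha hb
    obtain ⟨u, hu, hu'⟩ := hnot a ha
    obtain ⟨v, hv, hv'⟩ := hnot b hb
    exact hmem _ (u * v) (by rw [mul_pow, hu, hv, map_mul]) (by rw [map_mul, hu', hv', neg_mul_neg])
  have h0 : (0 : F) ∈ P := by simpa using hsq 0
  have h1 : (1 : F) ∈ P := by simpa using hsq 1
  have hinv : ∀ {a : F}, a ∈ P → a⁻¹ ∈ P := by
    intro a ha
    rcases eq_or_ne a 0 with rfl | ha0
    · simpa using h0
    have := hmul ha (hsq a⁻¹)
    rwa [← mul_assoc, mul_inv_cancel₀ ha0, one_mul] at this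
  have hm : ∀ {a : F}, a ≠ 0 → -(a * a) ∉ P := by
    intro a ha h
    apply hm1
    have := hmul h (hsq a⁻¹)
    convert this using 1
    field_simp
  have hadd : ∀ {a b : F}, a ∈ P → b ∈ P → a + b ∈ P := by
    intro a b ha hb
    by_contra hab
    have ha0 : a ≠ 0 := by
      rintro rfl
      exact hab (by rwa [zero_add])
    -- Dividing by `a` reduces to `1 + t` with `t` positive. If `1 + t` is negative, then `τ`
    -- negates both `s = √(-t)` and `r = √(1 + t)`, and `r ^ 2 = 1 - s ^ 2`.
    set t := b * a⁻¹ with ht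
    have htP : t ∈ P := hmul hb (hinv ha)
    have h1t : 1 + t ∉ P := by
      intro h
      apply hab
      have := hmul ha h
      convert this using 1
      rw [ht]
      field_simp
    have ht0 : t ≠ 0 := by
      intro h
      rw [h, add_zero] at h1t
      exact h1t h1
    have hmt : -t ∉ P := by
      intro h
      apply hm ht0
      rw [← mul_neg]
      exact hmul htP h
    obtain ⟨s, hs, hs'⟩ := hnot _ hmt
    obtain ⟨r, hr, hr'⟩ := hnot _ h1t
    obtain ⟨y, hy⟩ := hroot (1 + s)
    have hr0 : r ≠ 0 := by
      rintro rfl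
      apply h1t
      have : algebraMap F Ω (1 + t) = 0 := by rw [← hr]; simp
      rw [(map_eq_zero _).1 this]
      exact h0
    have hs0 : s ≠ 0 := by
      rintro rfl
      have : algebraMap F Ω (-t) = 0 := by rw [← hs]; simp
      exact ht0 (neg_eq_zero.1 ((map_eq_zero _).1 this))
    refine sq_apply_ne_of_apply_eq_neg h2 τ hr0 hs' hr' ?_ hy
      (hB rfl s y ⟨_, hs.symm⟩ (fun h => ?_) hy)
    · rw [hr, hs]
      simp
    · rw [h] at hs'
      exact mul_ne_zero h2 hs0 (by linear_combination hs')
  let O : RingPreordering F :=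
    { carrier := P
      zero_mem' := h0
      one_mem' := h1
      add_mem' := hadd
      mul_mem' := hmul
      mem_of_isSquare' := by
        rintro _ ⟨a, rfl⟩
        exact hsq a
      neg_one_notMem' := hm1 }
  have : HasMemOrNegMem O := ⟨fun a => by
    by_contra! h
    have h' : a ∉ P ∧ -a ∉ P := h
    rcases eq_or_ne a 0 with rfl | ha0
    · exact h'.1 h0
    -- If `a` and `-a` were both negative, their product `-(a * a)` would be positive.
    · exact hm ha0 (by simpa using hmul' h'.1 h'.2)⟩
  exact ⟨O, { mem_or_neg_mem := this.mem_or_neg_mem, toIsPrime := inferInstance }, rfl⟩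

theorem mem_adjoin_of_sq {K Ω : Type*} [Field K] [Field Ω] [Algebra K Ω]
    {b : Ω} {a : K} (hb : b ^ 2 = algebraMap K Ω a) {z : Ω} (hz : z ∈ K⟮b⟯) :
    ∃ u v : K, z = algebraMap K Ω u + algebraMap K Ω v * b := by
  have hint : IsIntegral K b := by
    refine IsIntegral.of_pow two_pos ?_
    rw [hb]
    exact isIntegral_algebraMap
  have hz' : z ∈ Algebra.adjoin K {b} := by
    rw [← IntermediateField.adjoin_simple_toSubalgebra_of_isAlgebraic hint.isAlgebraic]
    exact hz
  induction hz' using Algebra.adjoin_induction with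
  | mem x hx =>
    obtain rfl := hx
    exact ⟨0, 1, by simp⟩
  | algebraMap r => exact ⟨r, 0, by simp⟩
  | add x y hx hy ihx ihy =>
    obtain ⟨u, v, rfl⟩ := ihx (IntermediateField.algebra_adjoin_le_adjoin K _ hx)
    obtain ⟨u', v', rfl⟩ := ihy (IntermediateField.algebra_adjoin_le_adjoin K _ hy)
    exact ⟨u + u', v + v', by simp only [map_add]; ring⟩
  | mul x y hx hy ihx ihy =>
    obtain ⟨u, v, rfl⟩ := ihx (IntermediateField.algebra_adjoin_le_adjoin K _ hx)
    obtain ⟨u', v', rfl⟩ := ihy (IntermediateField.algebra_adjoin_le_adjoin K _ hy)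
    refine ⟨u * u' + a * v * v', u * v' + v * u', ?_⟩
    simp only [map_add, map_mul, ← hb]
    ring

/-! ### Kummer theory and the Frattini subgroup. -/

section Kummer

variable {K Ω : Type*} [Field K] [Field Ω] [Algebra K Ω] {p : ℕ}

/-- Kummer theory: adjoining a `p`-th root gives a trivial or a cyclic extension. -/
theorem isCyclicOfDegree_adjoin (hp : p.Prime) {ξ : K} (hξ : IsPrimitiveRoot ξ p) {x : Ω}
    (hx : x ^ p ∈ (algebraMap K Ω).range) (hxK : x ∉ (algebraMap K Ω).range) :
    IsCyclicOfDegree p K K⟮x⟯ := by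
  obtain ⟨a, ha⟩ := hx
  have : NeZero p := ⟨hp.ne_zero⟩
  have hirr : Irreducible (Polynomial.X ^ p - Polynomial.C a) := by
    apply X_pow_sub_C_irreducible_of_prime hp
    -- For prime `p`, irreducibility only requires that `a` is not a `p`-th power in `K`. A root `b`
    -- in `K` would differ from `x` by a root of unity of `K`, forcing `x` into `K`.
    intro b hb
    apply hxK
    have hb0 : algebraMap K Ω b ≠ 0 := by
      intro h
      rw [map_eq_zero] at h
      rw [← hb, h, zero_pow hp.ne_zero, map_zero] at ha
      exact hxK ⟨0, by rw [map_zero, pow_eq_zero_iff hp.ne_zero |>.1 ha.symm]⟩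
    have hw : (x / algebraMap K Ω b) ^ p = 1 := by
      rw [div_pow, ← ha, ← map_pow, hb, div_self]
      rw [← hb, map_pow]
      exact pow_ne_zero p hb0
    obtain ⟨v, -, hv⟩ := exists_algebraMap_eq_of_pow_eq_one hp hξ hw
    exact ⟨v * b, by rw [map_mul, hv, div_mul_cancel₀ _ hb0]⟩
  have hne : (primitiveRoots p K).Nonempty := ⟨ξ, (mem_primitiveRoots hp.pos).2 hξ⟩
  have hint : IsIntegral K x := by
    refine IsIntegral.of_pow hp.pos ?_
    rw [← ha]
    exact isIntegral_algebraMap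
  have hfin := IntermediateField.adjoin.finiteDimensional hint
  have hmin : minpoly K x = Polynomial.X ^ p - Polynomial.C a := by
    refine (minpoly.eq_of_irreducible_of_monic hirr ?_
      (Polynomial.monic_X_pow_sub_C a hp.ne_zero)).symm
    simp [ha]
  have hrank : Module.finrank K K⟮x⟯ = p := by
    rw [IntermediateField.adjoin.finrank hint, hmin, Polynomial.natDegree_X_pow_sub_C]
  have hroot : (IntermediateField.AdjoinSimple.gen K x) ^ (Module.finrank K K⟮x⟯) =
      algebraMap K K⟮x⟯ a := by
    rw [hrank]
    apply Subtype.ext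
    exact ha.symm
  have htop : K⟮IntermediateField.AdjoinSimple.gen K x⟯ = ⊤ := by
    apply IntermediateField.lift_injective
    rw [IntermediateField.lift_adjoin_simple, IntermediateField.lift_top]
    rfl
  have := isSplittingField_X_pow_sub_C_of_root_adjoin_eq_top 
    (by rw [hrank]; exact hne) hroot htop
  rw [hrank] at this
  exact ⟨isGalois_of_isSplittingField_X_pow_sub_C hne hirr _,
    isCyclic_of_isSplittingField_X_pow_sub_C hne hirr _, hrank⟩

theorem mem_cyclicCompositum_of_pow (hp : p.Prime) {ξ : K} (hξ : IsPrimitiveRoot ξ p) {x : Ω}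
    (hx : x ^ p ∈ (algebraMap K Ω).range) : x ∈ cyclicCompositum p K Ω := by
  by_cases hxK : x ∈ (algebraMap K Ω).range
  · obtain ⟨a, rfl⟩ := hxK
    exact IntermediateField.algebraMap_mem _ a
  · exact le_iSup (fun L : {L : IntermediateField K Ω // IsCyclicOfDegree p K L} => L.1)
      ⟨K⟮x⟯, isCyclicOfDegree_adjoin hp hξ hx hxK⟩ (IntermediateField.mem_adjoin_simple_self K x)

/-- The converse half of Kummer theory: a cyclic extension of degree `p` is generated by one `p`-th
root of an element of `K`. -/
theorem le_of_isCyclicOfDegree (hp : p.Prime) {ξ : K} (hξ : IsPrimitiveRoot ξ p)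
    (L : IntermediateField K Ω) (hL : IsCyclicOfDegree p K L)
    {S : IntermediateField K Ω} (hS : ∀ x : Ω, x ^ p ∈ (algebraMap K Ω).range → x ∈ S) :
    L ≤ S := by
  have := hL.isGalois
  have := hL.isCyclic
  have hrank := hL.finrank_eq
  have : FiniteDimensional K L := Module.finite_of_finrank_pos (by rw [hrank]; exact hp.pos)
  have hne : (primitiveRoots (Module.finrank K L) K).Nonempty :=
    ⟨ξ, by rw [hrank]; exact (mem_primitiveRoots hp.pos).2 hξ⟩
  obtain ⟨α, ⟨a, ha⟩, htop⟩ := exists_root_adjoin_eq_top_of_isCyclic K L hne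
  have hαS : (α : Ω) ∈ S := hS _ ⟨a, by
    rw [hrank] at ha
    exact congrArg Subtype.val ha⟩
  have hle : K⟮α⟯.map L.val ≤ S := by
    rw [IntermediateField.adjoin_map, IntermediateField.adjoin_le_iff]
    simpa using hαS
  rw [htop] at hle
  intro x hx
  exact hle ⟨⟨x, hx⟩, trivial, rfl⟩

theorem cyclicCompositum_le (hp : p.Prime) {ξ : K} (hξ : IsPrimitiveRoot ξ p)
    {S : IntermediateField K Ω} (hS : ∀ x : Ω, x ^ p ∈ (algebraMap K Ω).range → x ∈ S) :
    cyclicCompositum p K Ω ≤ S :=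
  iSup_le fun L => le_of_isCyclicOfDegree hp hξ L.1 L.2 hS

/-- An automorphism outside the Frattini subgroup moves a `p`-th root of an element of `K`. -/
theorem exists_apply_ne_of_notMem_proPFrattini [IsGalois K Ω] (hp : p.Prime) {ξ : K}
    (hξ : IsPrimitiveRoot ξ p) {σ : Gal(Ω/K)} (hσ : σ ∉ proPFrattini p Gal(Ω/K)) :
    ∃ α : Ω, α ^ p ∈ (algebraMap K Ω).range ∧ σ α ≠ α := by
  by_contra! h
  refine hσ (mem_proPFrattini_of_fixes hp σ fun x hx => ?_)
  exact cyclicCompositum_le hp hξ (S := FixedBy.intermediateField K Ω σ) h hx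

/-- The subgroup `Δ^p[Δ,Δ]`, for `Δ` the group of `E`, fixes the `p`-th roots of elements of `E`. -/
theorem apply_eq_self_of_mem_pFrattiniOf [Algebra.IsIntegral K Ω] (hp : p.Prime) {ξ : K}
    (hξ : IsPrimitiveRoot ξ p) {E : IntermediateField K Ω} {β : Ω} (hβ : β ^ p ∈ E)
    {g : Gal(Ω/K)} (hg : g ∈ pFrattiniOf p E.fixingSubgroup) : g β = β := by
  have hmul : ∀ g ∈ E.fixingSubgroup, ∃ w : K, g β = algebraMap K Ω w * β := by
    intro g hg
    obtain ⟨w, hw, hgw⟩ := exists_apply_eq_mul g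
      ((IntermediateField.mem_fixingSubgroup_iff _ _).1 hg _ hβ)
    obtain ⟨v, -, rfl⟩ := exists_algebraMap_eq_of_pow_eq_one hp hξ hw
    exact ⟨v, hgw⟩
  have hle : pFrattiniOf p E.fixingSubgroup ≤ MulAction.stabilizer Gal(Ω/K) β := by
    apply Subgroup.topologicalClosure_minimal
    · rw [Subgroup.closure_le]
      rintro x (⟨g, hg, rfl⟩ | ⟨g, hg, h, hh, rfl⟩)
      · exact pow_apply_eq_self hp hξ g
          ((IntermediateField.mem_fixingSubgroup_iff _ _).1 hg _ hβ)
      · change (g * h * g⁻¹ * h⁻¹) β = β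
        -- Elements of the group of `E` scale `β` by constants of `K`, which every automorphism
        -- fixes; their actions on `β` therefore commute.
        rcases eq_or_ne β 0 with rfl | hβ0
        · exact map_zero _
        obtain ⟨w₁, h₁⟩ := hmul g hg
        obtain ⟨w₂, h₂⟩ := hmul h hh
        obtain ⟨w₃, h₃⟩ := hmul g⁻¹ (inv_mem hg)
        obtain ⟨w₄, h₄⟩ := hmul h⁻¹ (inv_mem hh)
        have e₁ : (g * g⁻¹) β = β := by rw [mul_inv_cancel]; rfl
        have e₂ : (h * h⁻¹) β = β := by rw [mul_inv_cancel]; rfl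
        simp only [AlgEquiv.mul_apply, h₁, h₂, h₃, h₄, map_mul, AlgEquiv.commutes] at e₁ e₂ ⊢
        linear_combination (algebraMap K Ω w₂ * algebraMap K Ω w₄) * e₁ + e₂
    -- The stabilizer of an algebraic element is open, hence closed, so it absorbs the topological
    -- closure as well.
    · exact OpenSubgroup.isClosed ⟨_, stabilizer_isOpen_of_isIntegral β⟩
  exact hle hg

theorem notMem_proPFrattini_of_apply_ne [Algebra.IsIntegral K Ω] (hp : p.Prime) {ξ : K}
    (hξ : IsPrimitiveRoot ξ p) {β : Ω} (hβ : β ^ p ∈ (algebraMap K Ω).range)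
    {g : Gal(Ω/K)} (hg : g β ≠ β) : g ∉ proPFrattini p Gal(Ω/K) := by
  intro h
  refine hg (apply_eq_self_of_mem_pFrattiniOf (E := ⊥) hp hξ ?_ ?_)
  · rwa [IntermediateField.mem_bot]
  · rwa [IntermediateField.fixingSubgroup_bot]

end Kummer

/-! ### The fields `F^(2)`, `F^(3)` and `F^(2)^(2)`. -/

section Tower

variable {F Ω : Type*} [Field F] [Field Ω] [Algebra F Ω] {p : ℕ}

theorem isPrimitiveRoot_algebraMap {ξ : F} (hξ : IsPrimitiveRoot ξ p)
    (N : IntermediateField F Ω) : IsPrimitiveRoot (algebraMap F N ξ) p :=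
  hξ.map_of_injective (algebraMap F N).injective

theorem mem_range_algebraMap_iff {N : IntermediateField F Ω} {x : Ω} :
    x ∈ (algebraMap N Ω).range ↔ x ∈ N :=
  ⟨fun ⟨a, ha⟩ => ha ▸ a.2, fun h => ⟨⟨x, h⟩, rfl⟩⟩

theorem cyclicCompositum_le_doubleCyclicCompositum :
    cyclicCompositum p F Ω ≤ doubleCyclicCompositum p F Ω := fun x hx =>
  (cyclicCompositum p (cyclicCompositum p F Ω) Ω).algebraMap_mem ⟨x, hx⟩

theorem cyclicCompositum_le_galoisCyclicCompositum :
    cyclicCompositum p F Ω ≤ galoisCyclicCompositum p F Ω := fun x hx =>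
  IntermediateField.algebraMap_mem
    (⨆ L : {L : IntermediateField (cyclicCompositum p F Ω) Ω //
      IsCyclicOfDegree p (cyclicCompositum p F Ω) L ∧ IsGalois F L}, L.1) ⟨x, hx⟩

theorem galoisCyclicCompositum_le_doubleCyclicCompositum :
    galoisCyclicCompositum p F Ω ≤ doubleCyclicCompositum p F Ω := by
  intro x hx
  have hle : (⨆ L : {L : IntermediateField (cyclicCompositum p F Ω) Ω //
      IsCyclicOfDegree p (cyclicCompositum p F Ω) L ∧ IsGalois F L}, L.1) ≤
      cyclicCompositum p (cyclicCompositum p F Ω) Ω :=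
    iSup_le fun L => le_iSup (fun L : {L : IntermediateField (cyclicCompositum p F Ω) Ω //
      IsCyclicOfDegree p (cyclicCompositum p F Ω) L} => L.1) ⟨L.1, L.2.1⟩
  exact hle hx

instance normal_cyclicCompositum : Normal F (cyclicCompositum p F Ω) := by
  have : ∀ L : {L : IntermediateField F Ω // IsCyclicOfDegree p F L}, Normal F L.1 := fun L =>
    L.2.isGalois.to_normal
  exact IntermediateField.normal_iSup _ _ _

theorem apply_mem_of_normal (N : IntermediateField F Ω) [Normal F N] (g : Gal(Ω/F)) {x : Ω}
    (hx : x ∈ N) : g x ∈ N := by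
  have := AlgEquiv.restrictNormal_commutes g N ⟨x, hx⟩
  rw [show g x = g (algebraMap N Ω ⟨x, hx⟩) from rfl, ← this]
  exact (AlgEquiv.restrictNormal g N ⟨x, hx⟩).2

theorem normal_of_forall_apply_mem [Normal F Ω] (M : IntermediateField F Ω)
    (h : ∀ g : Gal(Ω/F), ∀ x ∈ M, g x ∈ M) : Normal F M := by
  rw [IntermediateField.normal_iff_forall_map_le']
  rintro g _ ⟨x, hx, rfl⟩
  exact h g x hx

theorem mem_doubleCyclicCompositum (hp : p.Prime) {ξ : F} (hξ : IsPrimitiveRoot ξ p) {y : Ω}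
    (hy : y ^ p ∈ cyclicCompositum p F Ω) : y ∈ doubleCyclicCompositum p F Ω :=
  mem_cyclicCompositum_of_pow hp (isPrimitiveRoot_algebraMap hξ _) (mem_range_algebraMap_iff.2 hy)

variable [IsGalois F Ω]

theorem normal_galoisCyclicCompositum : Normal F (galoisCyclicCompositum p F Ω) := by
  apply normal_of_forall_apply_mem
  intro g x hx
  set N := cyclicCompositum p F Ω
  have hN : N ≤ (galoisCyclicCompositum p F Ω).comap g.toAlgHom := fun x hx =>
    cyclicCompositum_le_galoisCyclicCompositum (apply_mem_of_normal N g hx)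
  have hle : (⨆ L : {L : IntermediateField N Ω // IsCyclicOfDegree p N L ∧ IsGalois F L}, L.1) ≤
      IntermediateField.extendScalars hN := by
    refine iSup_le fun L y hy => ?_
    have : Normal F (L.1.restrictScalars F) := L.2.2.to_normal
    have hy' : g y ∈ L.1 := apply_mem_of_normal (L.1.restrictScalars F) g hy
    exact le_iSup (fun L : {L : IntermediateField N Ω // IsCyclicOfDegree p N L ∧
      IsGalois F L} => L.1) L hy'
  exact hle hx

/-- An automorphism over `F` preserves `F^(2)`, so it permutes the `p`-th roots of its elements, and
these generate the field. -/
theorem normal_doubleCyclicCompositum (hp : p.Prime) {ξ : F} (hξ : IsPrimitiveRoot ξ p) :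
    Normal F (doubleCyclicCompositum p F Ω) := by
  apply normal_of_forall_apply_mem
  intro g x hx
  set N := cyclicCompositum p F Ω
  have hN : N ≤ (doubleCyclicCompositum p F Ω).comap g.toAlgHom := fun x hx =>
    cyclicCompositum_le_doubleCyclicCompositum (apply_mem_of_normal N g hx)
  have hle : cyclicCompositum p N Ω ≤ IntermediateField.extendScalars hN := by
    refine cyclicCompositum_le hp (isPrimitiveRoot_algebraMap hξ _) fun y hy => ?_
    refine mem_doubleCyclicCompositum hp hξ ?_
    change (g y) ^ p ∈ N
    rw [← map_pow]
    exact apply_mem_of_normal N g (mem_range_algebraMap_iff.1 hy)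
  exact hle hx

/-- The second hypothesis makes `F^(2)(y)` stable under all automorphisms over `F`, hence Galois
over `F`, so it is one of the fields composing `F^(3)`. -/
theorem mem_galoisCyclicCompositum (hp : p.Prime) {ξ : F} (hξ : IsPrimitiveRoot ξ p) {y : Ω}
    (hy : y ^ p ∈ cyclicCompositum p F Ω)
    (hg : ∀ g : Gal(Ω/F), g y ∈ (cyclicCompositum p F Ω)⟮y⟯) :
    y ∈ galoisCyclicCompositum p F Ω := by
  set N := cyclicCompositum p F Ω with hNdef
  by_cases hyN : y ∈ N
  · exact cyclicCompositum_le_galoisCyclicCompositum hyN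
  have hcyc : IsCyclicOfDegree p N N⟮y⟯ :=
    isCyclicOfDegree_adjoin hp (isPrimitiveRoot_algebraMap hξ N) (mem_range_algebraMap_iff.2 hy)
      (fun h => hyN (mem_range_algebraMap_iff.1 h))
  have hnorm : Normal F (N⟮y⟯.restrictScalars F) := by
    apply normal_of_forall_apply_mem
    intro g x hx
    have hN : N ≤ (N⟮y⟯.restrictScalars F).comap g.toAlgHom := fun x hx =>
      N⟮y⟯.algebraMap_mem ⟨g x, apply_mem_of_normal N g hx⟩
    have hle : N⟮y⟯ ≤ IntermediateField.extendScalars hN := by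
      rw [IntermediateField.adjoin_simple_le_iff]
      exact hg g
    exact hle hx
  have hgal : IsGalois F (N⟮y⟯.restrictScalars F) := {}
  exact le_iSup (fun L : {L : IntermediateField N Ω // IsCyclicOfDegree p N L ∧
      IsGalois F L} => L.1) ⟨N⟮y⟯, hcyc, hgal⟩ (IntermediateField.mem_adjoin_simple_self N y)

/-- The `p`-th roots of `p`-th roots of elements of `F` lie in `F^(3)`. -/
theorem mem_galoisCyclicCompositum_of_pow_pow (hp : p.Prime) {ξ : F} (hξ : IsPrimitiveRoot ξ p)
    {α β : Ω} (hα : α ^ p ∈ (algebraMap F Ω).range) (hβ : β ^ p = α) :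
    β ∈ galoisCyclicCompositum p F Ω := by
  set N := cyclicCompositum p F Ω with hN
  have hαN : α ∈ N := mem_cyclicCompositum_of_pow hp hξ hα
  refine mem_galoisCyclicCompositum hp hξ (by rw [hβ]; exact hαN) fun g => ?_
  rcases eq_or_ne β 0 with rfl | hβ0
  · rw [map_zero]
    exact zero_mem _
  -- The `p`-th power of this quotient is `g α / α`, a root of unity in `F`; so the quotient is a
  -- `p`-th root of an element of `F`.
  have hη : g β / β ∈ N := by
    refine mem_cyclicCompositum_of_pow hp hξ ?_
    obtain ⟨w, hw, hgw⟩ := exists_apply_eq_mul g (p := p) (y := α) (by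
      obtain ⟨a, ha⟩ := hα
      rw [← ha]
      exact g.commutes a)
    obtain ⟨v, -, hv⟩ := exists_algebraMap_eq_of_pow_eq_one hp hξ hw
    refine ⟨v, ?_⟩
    have hα0 : α ≠ 0 := hβ ▸ pow_ne_zero p hβ0
    rw [div_pow, ← map_pow, hβ, hgw, mul_div_cancel_right₀ _ hα0, hv]
  rw [← div_mul_cancel₀ (g β) hβ0]
  exact mul_mem (N⟮β⟯.algebraMap_mem ⟨_, hη⟩) (IntermediateField.mem_adjoin_simple_self N β)

/-- The square roots of `1 + s`, with `s ^ 2 ∈ F`, lie in `F^(3)`. -/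
theorem mem_galoisCyclicCompositum_of_sq_eq_one_add {ξ : F} (hξ : IsPrimitiveRoot ξ 2)
    {s y : Ω} (hs : s ^ 2 ∈ (algebraMap F Ω).range) (hy : y ^ 2 = 1 + s) :
    y ∈ galoisCyclicCompositum 2 F Ω := by
  set N := cyclicCompositum 2 F Ω with hN
  have hsN : s ∈ N := mem_cyclicCompositum_of_pow Nat.prime_two hξ hs
  refine mem_galoisCyclicCompositum Nat.prime_two hξ
    (by rw [hy]; exact add_mem (one_mem _) hsN) fun g => ?_
  have hyL : y ∈ N⟮y⟯ := IntermediateField.mem_adjoin_simple_self N y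
  rcases eq_or_ne y 0 with rfl | hy0
  · rw [map_zero]
    exact zero_mem _
  have hgs : g s = s ∨ g s = -s := by
    rw [← sq_eq_sq_iff_eq_or_eq_neg, ← map_pow]
    obtain ⟨a, ha⟩ := hs
    rw [← ha, g.commutes]
  have hgy : (g y) ^ 2 = 1 + g s := by rw [← map_pow, hy, map_add, map_one]
  rcases hgs with h | h
  · rw [h, ← hy, sq_eq_sq_iff_eq_or_eq_neg] at hgy
    rcases hgy with h | h
    · rw [h]
      exact hyL
    · rw [h]
      exact neg_mem hyL
  · obtain ⟨a, ha⟩ := hs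
    -- When `g` negates `s`, the square of this product is `1 - s ^ 2`, an element of `F`.
    have hr : y * g y ∈ N := by
      refine mem_cyclicCompositum_of_pow Nat.prime_two hξ ⟨1 - a, ?_⟩
      rw [mul_pow, hgy, hy, h, map_sub, ha, map_one]
      ring
    rw [← mul_div_cancel_left₀ (g y) hy0]
    exact div_mem (N⟮y⟯.algebraMap_mem ⟨_, hr⟩) hyL

end Tower

/-! ### Maximal subfields in which `-1` is not a sum of squares. -/

section FormallyReal

theorem IsSumSq.map_ringHom {R S : Type*} [Semiring R] [Semiring S] (f : R →+* S) {s : R}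
    (hs : IsSumSq s) : IsSumSq (f s) := by
  induction hs with
  | zero => simp
  | sq_add a hs ih =>
    rw [map_add, map_mul]
    exact ih.sq_add _

theorem isSumSq_neg_one_of_not_isFormallyReal {K : Type*} [Field K] (h : ¬ IsFormallyReal K) :
    IsSumSq (-1 : K) := by
  by_contra hK
  refine h (IsFormallyReal.of_eq_zero_of_eq_zero_of_mul_self_add fun {s a} hs h0 => ?_)
  by_contra ha
  apply hK
  have : (-1 : K) = s * (a⁻¹ * a⁻¹) := by
    field_simp
    linear_combination -h0
  rw [this]
  exact hs.mul (IsSumSq.mul_self _)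

theorem not_isSumSq_neg_one {K : Type*} [Field K] [IsFormallyReal K] : ¬ IsSumSq (-1 : K) :=
  fun h => one_ne_zero (IsFormallyReal.eq_zero_of_isSumSq_of_neg_isSumSq
    (by simp) h)

variable {F Ω : Type*} [Field F] [Field Ω] [Algebra F Ω]

theorem exists_maximal_not_isSumSq_neg_one (hF : ¬ IsSumSq (-1 : F)) :
    ∃ K : IntermediateField F Ω,
      Maximal (fun K : IntermediateField F Ω => ¬ IsSumSq (-1 : K)) K := by
  have hbot : ¬ IsSumSq (-1 : (⊥ : IntermediateField F Ω)) := fun h =>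
    hF (by simpa using IsSumSq.map_ringHom (IntermediateField.botEquiv F Ω : _ →+* F) h)
  refine (zorn_le_nonempty₀ {K : IntermediateField F Ω | ¬ IsSumSq (-1 : K)}
    (fun c hc hchain K₀ hK₀ => ?_) ⊥ hbot).imp fun K hK => hK.2
  have hne : Nonempty c := ⟨⟨K₀, hK₀⟩⟩
  have hdir : Directed (· ≤ ·) fun i : c => i.1 := hchain.directedOn.directed_val
  refine ⟨⨆ i : c, i.1, fun h => ?_, fun z hz => le_iSup (fun i : c => i.1) ⟨z, hz⟩⟩
  -- A sum of squares involves finitely many elements, so it already lives in a single member of the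
  -- chain.
  have key : ∀ z : (⨆ i : c, i.1 : IntermediateField F Ω), IsSumSq z →
      ∃ i : c, ∃ s : i.1, IsSumSq s ∧ (s : Ω) = z := by
    intro z hz
    induction hz with
    | zero => exact ⟨⟨K₀, hK₀⟩, 0, IsSumSq.zero, by simp⟩
    | sq_add x hs ih =>
      obtain ⟨i, s, hs, h⟩ := ih
      obtain ⟨j, hj⟩ : ∃ j : c, (x : Ω) ∈ j.1 := by
        have : (x : Ω) ∈ ((⨆ i : c, i.1 : IntermediateField F Ω) : Set Ω) := x.2
        rw [IntermediateField.coe_iSup_of_directed hdir] at this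
        simpa using this
      obtain ⟨k, hik, hjk⟩ := hdir i j
      refine ⟨k, ⟨x, hjk hj⟩ * ⟨x, hjk hj⟩ + IntermediateField.inclusion hik s,
        (IsSumSq.map_ringHom (IntermediateField.inclusion hik : i.1 →+* k.1) hs).sq_add _, ?_⟩
      push_cast
      rw [← h]
      rfl
  obtain ⟨i, s, hs, h⟩ := key _ h
  refine hc i.2 ?_
  convert hs
  apply Subtype.ext
  rw [h]
  simp

/-- If `a` is not a square, maximality makes `-1` a sum of squares in `K(√a)`, and this forces `-a`
to be a sum of squares in `K`. If neither `a` nor `-a` were a square, `-a ^ 2` would be a product of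
two sums of squares, and so `-1` would be a sum of squares. -/
theorem isSquare_or_isSquare_neg {K : IntermediateField F Ω} (hroot : ∀ x : Ω, ∃ y : Ω, y ^ 2 = x)
    (hK : Maximal (fun K : IntermediateField F Ω => ¬ IsSumSq (-1 : K)) K) (a : K) :
    (∃ b : K, a = b ^ 2) ∨ ∃ b : K, -a = b ^ 2 := by
  have key : ∀ a : K, (¬ ∃ b : K, a = b ^ 2) → IsSumSq (-a) := by
    intro a ha
    obtain ⟨b, hb⟩ := hroot (a : Ω)
    have hbK : b ∉ K := fun h => ha ⟨⟨b, h⟩, Subtype.ext hb.symm⟩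
    set C : IntermediateField F Ω := K⟮b⟯.restrictScalars F with hC
    have hKC : K ≤ C := fun x hx => K⟮b⟯.algebraMap_mem ⟨x, hx⟩
    have hbC : b ∈ C := IntermediateField.mem_adjoin_simple_self K b
    have hCs : IsSumSq (-1 : C) := by
      by_contra h
      exact hbK (hK.le_of_ge h hKC hbC)
    have hdec : ∀ z : C, IsSumSq z → ∃ s t c : K, IsSumSq s ∧ IsSumSq t ∧
        (z : Ω) = s + a * t + c * b := by
      intro z hz
      induction hz with
      | zero => exact ⟨0, 0, 0, IsSumSq.zero, IsSumSq.zero, by simp⟩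
      | sq_add x hs ih =>
        obtain ⟨s, t, c, hs, ht, h⟩ := ih
        obtain ⟨u, v, huv⟩ := mem_adjoin_of_sq (K := K) (b := b) (a := a) hb (z := x) x.2
        refine ⟨u * u + s, v * v + t, u * v + u * v + c, hs.sq_add _, ht.sq_add _, ?_⟩
        have huv' : (x : Ω) = u + v * b := huv
        push_cast
        rw [h, huv', ← hb]
        ring
    obtain ⟨s, t, c, hs, ht, h⟩ := hdec _ hCs
    -- A nonzero coefficient would let one solve for `b` inside `K`.
    have hc : c = 0 := by
      by_contra hc
      apply hbK
      have hc' : (c : Ω) ≠ 0 := fun h => hc (Subtype.ext h)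
      have : b = ((-1 - s - a * t) / c : K) := by
        push_cast at h ⊢
        field_simp
        linear_combination -h
      rw [this]
      exact Subtype.prop _
    have h' : (-1 : K) = s + a * t := by
      apply Subtype.ext
      rw [hc] at h
      push_cast at h ⊢
      linear_combination h
    have ht0 : t ≠ 0 := by
      rintro rfl
      apply hK.prop
      rw [h', mul_zero, add_zero]
      exact hs
    have : -a = ((1 * 1 + s) * t) * (t⁻¹ * t⁻¹) := by
      field_simp
      linear_combination h'
    rw [this]
    exact ((hs.sq_add 1).mul ht).mul (IsSumSq.mul_self _)
  by_contra! h
  have h1 := key a (by push Not; exact h.1)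
  have h2 := key (-a) (by push Not; exact h.2)
  have ha0 : a ≠ 0 := by
    rintro rfl
    exact h.1 0 (by simp)
  apply hK.prop
  have : (-1 : K) = (-a * -(-a)) * (a⁻¹ * a⁻¹) := by field_simp
  rw [this]
  exact (h1.mul h2).mul (IsSumSq.mul_self _)

/-- In a maximal formally real field `K`, the field `K(√-1)` is quadratically closed. -/
theorem mem_adjoin_of_sq_mem {K : IntermediateField F Ω} (h2 : (2 : Ω) ≠ 0)
    (hK : ¬ IsSumSq (-1 : K)) (hsq : ∀ a : K, (∃ b : K, a = b ^ 2) ∨ ∃ b : K, -a = b ^ 2)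
    {ι : Ω} (hι : ι ^ 2 = -1) {z : Ω} (hz : z ^ 2 ∈ K⟮ι⟯) : z ∈ K⟮ι⟯ := by
  have h2K : (2 : K) ≠ 0 := fun h => h2 (by
    have := congrArg (algebraMap K Ω) h
    rwa [map_ofNat, map_zero] at this)
  have hιC : ι ∈ K⟮ι⟯ := IntermediateField.mem_adjoin_simple_self K ι
  have hmem : ∀ a : K, (a : Ω) ∈ K⟮ι⟯ := fun a => K⟮ι⟯.algebraMap_mem a
  obtain ⟨x, y, hxy⟩ := mem_adjoin_of_sq (K := K) (a := -1) (by simpa using hι) hz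
  replace hxy : z ^ 2 = x + y * ι := hxy
  have hconcl : ∀ w ∈ K⟮ι⟯, z ^ 2 = w ^ 2 → z ∈ K⟮ι⟯ := by
    intro w hw h
    rcases sq_eq_sq_iff_eq_or_eq_neg.1 h with rfl | rfl
    · exact hw
    · exact neg_mem hw
  rcases eq_or_ne y 0 with rfl | hy0
  · rcases hsq x with ⟨e, he⟩ | ⟨e, he⟩
    · refine hconcl e (hmem e) ?_
      rw [hxy, he]
      simp
    · refine hconcl (e * ι) (mul_mem (hmem e) hιC) ?_
      rw [hxy, mul_pow, hι, ← neg_neg x, he]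
      simp
  -- The norm of `x + y * ι` is a square: if its negative were a nonzero square, dividing by it
  -- would write `-1` as a sum of two squares.
  have hd : ∃ d : K, x ^ 2 + y ^ 2 = d ^ 2 := by
    rcases hsq (x ^ 2 + y ^ 2) with h | ⟨d, hd⟩
    · exact h
    rcases eq_or_ne d 0 with rfl | hd0
    · exact ⟨0, by linear_combination -hd⟩
    exfalso
    apply hK
    have : (-1 : K) = x * d⁻¹ * (x * d⁻¹) + y * d⁻¹ * (y * d⁻¹) := by
      field_simp
      linear_combination hd
    rw [this]
    exact (IsSumSq.mul_self _).add (IsSumSq.mul_self _)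
  have hu : ∃ d u : K, x ^ 2 + y ^ 2 = d ^ 2 ∧ (d + x) / 2 = u ^ 2 ∧ u ≠ 0 := by
    have hne : ∀ d : K, x ^ 2 + y ^ 2 = d ^ 2 → d + x ≠ 0 := by
      intro d hd h
      have : y ^ 2 = 0 := by linear_combination hd - (x - d) * h
      exact hy0 (pow_eq_zero_iff two_ne_zero |>.1 this)
    obtain ⟨d, hd⟩ := hd
    rcases hsq ((d + x) / 2) with ⟨u, hu⟩ | ⟨u, hu⟩
    · refine ⟨d, u, hd, hu, ?_⟩
      rintro rfl
      apply hne d hd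
      field_simp at hu
      simpa using hu
    · have hu0 : u ≠ 0 := by
        rintro rfl
        apply hne d hd
        field_simp at hu
        rw [zero_pow two_ne_zero, mul_zero] at hu
        exact neg_eq_zero.1 hu
      refine ⟨-d, y / (2 * u), by rw [hd]; ring, ?_, div_ne_zero hy0 (mul_ne_zero h2K hu0)⟩
      have hu' : 2 * u ^ 2 = -(d + x) := by
        rw [← hu]
        field_simp
      field_simp
      linear_combination -hd + (x - d) * hu'
  obtain ⟨d, u, hd, hu, hu0⟩ := hu
  have hu' : 2 * u ^ 2 = d + x := by
    rw [← hu]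
    field_simp
  have hv : u ^ 2 - (y / (2 * u)) ^ 2 = x := by
    field_simp
    linear_combination -hd + (2 * u ^ 2 + d - x) * hu'
  have hv' : 2 * u * (y / (2 * u)) = y := by field_simp
  -- The usual formula for a complex square root: real part `u = √((d + x) / 2)`, and imaginary part
  -- determined by the cross term `y`.
  refine hconcl (u + (y / (2 * u) : K) * ι)
    (add_mem (hmem _) (mul_mem (hmem _) hιC)) ?_
  have hv1 : (u : Ω) ^ 2 - ((y / (2 * u) : K) : Ω) ^ 2 = x := by
    exact_mod_cast congrArg Subtype.val hv
  have hv2 : 2 * (u : Ω) * ((y / (2 * u) : K) : Ω) = y := by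
    have := congrArg (algebraMap K Ω) hv'
    rwa [map_mul, map_mul, map_ofNat] at this
  rw [hxy, ← hv1]
  linear_combination -ι * hv2 - ((y / (2 * u) : K) : Ω) ^ 2 * hι

end FormallyReal

/-- A formally real field has an automorphism of its separable closure that moves `√-1` and
acts as an involution on `F^(2)^(2)`. -/
theorem exists_involution_of_isFormallyReal {F Ω : Type*} [Field F] [Field Ω] [Algebra F Ω]
    [IsGalois F Ω] [IsFormallyReal F] {ξ : F} (hξ : IsPrimitiveRoot ξ 2) (h2 : (2 : Ω) ≠ 0)
    (hroot : ∀ x : Ω, ∃ y : Ω, y ^ 2 = x) :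
    ∃ τ : Gal(Ω/F), (∃ ι : Ω, ι ^ 2 = -1 ∧ τ ι ≠ ι) ∧
      ∀ x ∈ doubleCyclicCompositum 2 F Ω, τ (τ x) = x := by
  obtain ⟨K, hK⟩ := exists_maximal_not_isSumSq_neg_one (Ω := Ω)
    (not_isSumSq_neg_one (K := F))
  have hsq := isSquare_or_isSquare_neg hroot hK
  obtain ⟨ι, hι⟩ := hroot (-1)
  have hιK : ι ∉ (⊥ : IntermediateField K Ω) := by
    rw [IntermediateField.mem_bot]
    rintro ⟨i, hi⟩
    apply hK.prop
    have : (-1 : K) = i * i := by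
      apply (algebraMap K Ω).injective
      rw [map_mul, hi, map_neg, map_one, ← hι, pow_two]
    rw [this]
    exact IsSumSq.mul_self i
  rw [InfiniteGalois.mem_bot_iff_fixed] at hιK
  push Not at hιK
  obtain ⟨τ, hτ⟩ := hιK
  refine ⟨τ.restrictScalars F, ⟨ι, hι, hτ⟩, ?_⟩
  have hτι : τ ι = -ι := by
    refine (sq_eq_sq_iff_eq_or_eq_neg.1 ?_).resolve_left hτ
    rw [← map_pow, hι, map_neg, map_one]
  have hfix : ∀ z ∈ K⟮ι⟯, τ (τ z) = z := by
    intro z hz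
    obtain ⟨u, v, rfl⟩ := mem_adjoin_of_sq (K := K) (a := -1) (by simpa using hι) hz
    simp only [map_add, map_mul, AlgEquiv.commutes, hτι, map_neg, neg_neg]
  have hclosed : ∀ z : Ω, z ^ 2 ∈ K⟮ι⟯ → z ∈ K⟮ι⟯ := fun z hz =>
    mem_adjoin_of_sq_mem h2 hK.prop hsq hι hz
  -- By Kummer theory a field closed under square roots absorbs each of the two layers in turn.
  have hN : cyclicCompositum 2 F Ω ≤ K⟮ι⟯.restrictScalars F := by
    refine cyclicCompositum_le Nat.prime_two hξ ?_
    rintro x ⟨a, ha⟩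
    refine hclosed x ?_
    rw [← ha]
    exact (K⟮ι⟯.restrictScalars F).algebraMap_mem a
  have hle : cyclicCompositum 2 (cyclicCompositum 2 F Ω) Ω ≤
      IntermediateField.extendScalars hN := by
    refine cyclicCompositum_le Nat.prime_two (isPrimitiveRoot_algebraMap hξ _) ?_
    rintro x ⟨a, ha⟩
    refine hclosed x ?_
    rw [← ha]
    exact hN a.2
  exact fun x hx => hfix x (hle hx)

/-! ### Passing between `Ω` and its normal subfields. -/

section Lift

variable {F Ω : Type*} [Field F] [Field Ω] [Algebra F Ω] {p : ℕ}

/-- Fixed square roots may be computed in a larger field. -/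
theorem fixedSquareRoots_eq {M : IntermediateField F Ω} {σ : Gal(M/F)} {τ : Gal(Ω/F)}
    (hτ : ∀ x : M, τ x = σ x) (hM : ∀ x : Ω, x ^ 2 ∈ (algebraMap F Ω).range → x ∈ M) :
    fixedSquareRoots σ = fixedSquareRoots τ := by
  ext a
  refine ⟨fun h x hx => ?_, fun h x hx => ?_⟩
  · have hxM := hM x ⟨a, hx.symm⟩
    exact (hτ ⟨x, hxM⟩).trans (congrArg Subtype.val (h ⟨x, hxM⟩ (Subtype.ext hx)))
  · exact Subtype.ext ((hτ x).symm.trans (h x (congrArg Subtype.val hx)))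

theorem pow_apply_coe {M : IntermediateField F Ω} {σ : Gal(M/F)} {τ : Gal(Ω/F)}
    (hτ : ∀ x : M, τ x = σ x) (k : ℕ) (x : M) : (τ ^ k) x = ((σ ^ k) x : M) := by
  induction k generalizing x with
  | zero => rfl
  | succ k ih =>
    rw [pow_succ, pow_succ, AlgEquiv.mul_apply, AlgEquiv.mul_apply, hτ, ih]

theorem pow_eq_one_iff_forall_mem {M : IntermediateField F Ω} {σ : Gal(M/F)} {τ : Gal(Ω/F)}
    (hτ : ∀ x : M, τ x = σ x) (k : ℕ) : σ ^ k = 1 ↔ ∀ x ∈ M, (τ ^ k) x = x := by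
  refine ⟨fun h x hx => ?_, fun h => AlgEquiv.ext fun x => Subtype.ext ?_⟩
  · rw [pow_apply_coe hτ k ⟨x, hx⟩, h, AlgEquiv.one_apply]
  · rw [← pow_apply_coe hτ k x, h x x.2, AlgEquiv.one_apply]

/-- The moved element `α` excludes the trivial automorphism, so for prime `p` only the vanishing of
the `p`-th power is left to test. -/
theorem orderOf_eq_iff_forall_mem (hp : p.Prime) {M : IntermediateField F Ω} {σ : Gal(M/F)}
    {τ : Gal(Ω/F)} (hτ : ∀ x : M, τ x = σ x) {α : Ω} (hα : α ∈ M) (hne : τ α ≠ α) :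
    orderOf σ = p ↔ ∀ x ∈ M, (τ ^ p) x = x := by
  rw [← pow_eq_one_iff_forall_mem hτ]
  refine ⟨fun h => orderOf_dvd_iff_pow_eq_one.1 (dvd_of_eq h), fun h => ?_⟩
  have : Fact p.Prime := ⟨hp⟩
  refine orderOf_eq_prime h fun h1 => hne ?_
  have := (pow_eq_one_iff_forall_mem hτ 1).1 (by rw [h1, one_pow]) α hα
  rwa [pow_one] at this

theorem exists_lift [Normal F Ω] {M : IntermediateField F Ω} (σ : Gal(M/F)) :
    ∃ τ : Gal(Ω/F), ∀ x : M, τ x = σ x :=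
  ⟨σ.liftNormal Ω, fun x => σ.liftNormal_commutes Ω x⟩

theorem exists_restriction {M : IntermediateField F Ω} [Normal F M] (τ : Gal(Ω/F)) :
    ∃ σ : Gal(M/F), ∀ x : M, τ x = σ x :=
  ⟨AlgEquiv.restrictNormal τ M, fun x => (AlgEquiv.restrictNormal_commutes τ M x).symm⟩

/-- Being in the Frattini subgroup can be tested on `p`-th roots of elements of `F`. -/
theorem notMem_proPFrattini_iff [IsGalois F Ω] (hp : p.Prime) {ξ : F} (hξ : IsPrimitiveRoot ξ p)
    {M : IntermediateField F Ω} [Normal F M]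
    (hM : ∀ x : Ω, x ^ p ∈ (algebraMap F Ω).range → x ∈ M)
    {σ : Gal(M/F)} {τ : Gal(Ω/F)} (hτ : ∀ x : M, τ x = σ x) :
    σ ∉ proPFrattini p Gal(M/F) ↔
      ∃ α : Ω, α ^ p ∈ (algebraMap F Ω).range ∧ τ α ≠ α := by
  have : IsGalois F M := {}
  constructor
  · intro h
    obtain ⟨α, ⟨a, ha⟩, hα⟩ := exists_apply_ne_of_notMem_proPFrattini hp hξ h
    refine ⟨α, ⟨a, congrArg Subtype.val ha⟩, fun h => hα (Subtype.ext ?_)⟩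
    rw [← hτ, h]
  · rintro ⟨α, ⟨a, ha⟩, hα⟩
    refine notMem_proPFrattini_of_apply_ne hp hξ (β := ⟨α, hM α ⟨a, ha⟩⟩)
      ⟨a, Subtype.ext ha⟩ fun h => hα ?_
    exact (hτ ⟨α, _⟩).trans (congrArg Subtype.val h)

end Lift

/-! ### Elements of `V_F` and `W_F`, and their images in the `T`-groups. -/

section SeparableClosure

variable {F : Type*} [Field F] {p : ℕ}

theorem natCast_ne_zero_of_isPrimitiveRoot (hp : p.Prime) {ξ : F} (hξ : IsPrimitiveRoot ξ p) :
    (p : F) ≠ 0 := by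
  have : NeZero p := ⟨hp.ne_zero⟩
  exact hξ.neZero'.out

theorem exists_pow_eq_separableClosure (hp : p.Prime) {ξ : F} (hξ : IsPrimitiveRoot ξ p)
    (x : SeparableClosure F) : ∃ y : SeparableClosure F, y ^ p = x := by
  have : NeZero (p : SeparableClosure F) := ⟨by
    rw [← map_natCast (algebraMap F (SeparableClosure F))]
    exact (map_ne_zero _).2 (natCast_ne_zero_of_isPrimitiveRoot hp hξ)⟩
  exact IsSepClosed.exists_pow_nat_eq x p

/-- Elements of order `p` of `W_F` outside the Frattini subgroup. -/
theorem WGroup.eq_two_and_isFieldOrdering (hp : p.Prime) {ξ : F} (hξ : IsPrimitiveRoot ξ p)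
    {σ : WGroup p F} (hσ : σ ∉ proPFrattini p (WGroup p F)) (hord : orderOf σ = p) :
    p = 2 ∧ IsFieldOrdering (fixedSquareRoots σ) := by
  have := normal_galoisCyclicCompositum (F := F) (Ω := SeparableClosure F) (p := p)
  have hM : ∀ x : SeparableClosure F, x ^ p ∈ (algebraMap F (SeparableClosure F)).range →
      x ∈ galoisCyclicCompositum p F (SeparableClosure F) := fun x hx =>
    cyclicCompositum_le_galoisCyclicCompositum (mem_cyclicCompositum_of_pow hp hξ hx)
  obtain ⟨τ, hτ⟩ := exists_lift (Ω := SeparableClosure F) σ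
  have hfix : ∀ x ∈ galoisCyclicCompositum p F (SeparableClosure F), (τ ^ p) x = x :=
    (pow_eq_one_iff_forall_mem hτ p).1 (orderOf_dvd_iff_pow_eq_one.1 (dvd_of_eq hord))
  have hroot := exists_pow_eq_separableClosure hp hξ
  have hne := (notMem_proPFrattini_iff hp hξ hM hτ).1 hσ
  obtain ⟨rfl, hO⟩ := _root_.eq_two_and_isFieldOrdering hp hξ τ hroot
    (fun α β hα _ hβ => hfix β (mem_galoisCyclicCompositum_of_pow_pow hp hξ hα hβ))
    (by
      rintro rfl s y hs - hy
      exact hfix y (mem_galoisCyclicCompositum_of_sq_eq_one_add hξ hs hy)) hne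
  exact ⟨rfl, by rwa [fixedSquareRoots_eq hτ hM]⟩

/-- Elements of `V_F` outside the Frattini subgroup whose images in the `T`-groups have order at
most `p`. -/
theorem VGroup.eq_two_and_isFieldOrdering (hp : p.Prime) {ξ : F} (hξ : IsPrimitiveRoot ξ p)
    {σ : VGroup p F} (hσ : σ ∉ proPFrattini p (VGroup p F))
    (hT : ∀ (E : IntermediateField F (SeparableClosure F)) [IsCyclicOfDegree p F E],
      IsOfFinOrder (VGroup.toT hp E σ) ∧ orderOf (VGroup.toT hp E σ) ≤ p) :
    p = 2 ∧ IsFieldOrdering (fixedSquareRoots σ) := by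
  have := normal_doubleCyclicCompositum (Ω := SeparableClosure F) hp hξ
  have hM : ∀ x : SeparableClosure F, x ^ p ∈ (algebraMap F (SeparableClosure F)).range →
      x ∈ doubleCyclicCompositum p F (SeparableClosure F) := fun x hx =>
    cyclicCompositum_le_doubleCyclicCompositum (mem_cyclicCompositum_of_pow hp hξ hx)
  obtain ⟨τ, hτ⟩ := exists_lift (Ω := SeparableClosure F) σ
  have hfix : ∀ s y : SeparableClosure F, s ^ p ∈ (algebraMap F (SeparableClosure F)).range →
      τ s ≠ s → y ^ p ∈ F⟮s⟯ → (τ ^ p) y = y := by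
    intro s y hs hτs hy
    -- Because `τ` moves `s`, it is not in `F`, so `F(s)` is one of the fields `E` covered by the
    -- hypothesis.
    have hcyc : IsCyclicOfDegree p F F⟮s⟯ := by
      refine isCyclicOfDegree_adjoin hp hξ hs ?_
      rintro ⟨a, rfl⟩
      exact hτs (τ.commutes a)
    obtain ⟨hfin, hle⟩ := hT F⟮s⟯
    have hτp : τ ^ p ∈ F⟮s⟯.fixingSubgroup := by
      have hs' : (τ ^ p) s = s := pow_apply_eq_self hp hξ τ (by
        obtain ⟨a, ha⟩ := hs
        rw [← ha]
        exact τ.commutes a)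
      rw [IntermediateField.mem_fixingSubgroup_iff]
      exact fun x hx => (IntermediateField.adjoin_simple_le_iff
        (K := FixedBy.intermediateField F (SeparableClosure F) (τ ^ p))).2 hs' hx
    have hmk : ∀ k : ℕ, (VGroup.toT hp F⟮s⟯ σ) ^ k = 1 ↔
        τ ^ k ∈ pFrattiniOf p F⟮s⟯.fixingSubgroup := by
      intro k
      rw [← map_pow, ← map_one (VGroup.toT hp F⟮s⟯),
        VGroup.toT_apply hp F⟮s⟯ (σ ^ k) (τ ^ k) (pow_apply_coe hτ k),
        VGroup.toT_apply hp F⟮s⟯ 1 1 fun x => rfl, eq_comm, QuotientGroup.eq, inv_one, one_mul]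
    -- The `p`-th power of `τ` lies in the group of `E`, so its `p ^ 2`-th power is trivial in
    -- `T_{E/F}`. The order is thus a power of `p`, and being at most `p` it divides `p`.
    have hpp : (VGroup.toT hp F⟮s⟯ σ) ^ p ^ 2 = 1 := by
      rw [hmk, pow_two, pow_mul]
      exact pow_mem_pFrattiniOf p hτp
    obtain ⟨k, hk, hko⟩ := (Nat.dvd_prime_pow hp).1 (orderOf_dvd_of_pow_eq_one hpp)
    have hk1 : k ≤ 1 := by
      rw [hko] at hle
      by_contra! hk1
      have := Nat.pow_lt_pow_right hp.one_lt hk1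
      rw [pow_one] at this
      omega
    have hdvd : orderOf (VGroup.toT hp F⟮s⟯ σ) ∣ p := by
      rw [hko]
      simpa using pow_dvd_pow p hk1
    exact apply_eq_self_of_mem_pFrattiniOf hp hξ hy
      ((hmk p).1 (orderOf_dvd_iff_pow_eq_one.1 hdvd))
  obtain ⟨rfl, hO⟩ := _root_.eq_two_and_isFieldOrdering hp hξ τ
    (exists_pow_eq_separableClosure hp hξ)
    (fun α β hα hne hβ => hfix α β hα hne
      (by rw [hβ]; exact IntermediateField.mem_adjoin_simple_self F α))
    (fun _ s y hs hne hy => hfix s y hs hne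
      (by rw [hy]; exact add_mem (one_mem _) (IntermediateField.mem_adjoin_simple_self F s)))
    ((notMem_proPFrattini_iff hp hξ hM hτ).1 hσ)
  exact ⟨rfl, by rwa [fixedSquareRoots_eq hτ hM]⟩

/-- The restricted automorphism moves `√-1`, a square root of an element of `F`; this gives both its
nontriviality and its position outside the Frattini subgroup. -/
theorem VGroup.exists_orderOf_eq_two [IsFormallyReal F] {ξ : F} (hξ : IsPrimitiveRoot ξ 2) :
    ∃ σ : VGroup 2 F, σ ∉ proPFrattini 2 (VGroup 2 F) ∧ orderOf σ = 2 := by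
  have hp := Nat.prime_two
  have := normal_doubleCyclicCompositum (Ω := SeparableClosure F) hp hξ
  have h2 : (2 : SeparableClosure F) ≠ 0 := by
    rw [← map_ofNat (algebraMap F (SeparableClosure F))]
    exact (map_ne_zero _).2 (by exact_mod_cast natCast_ne_zero_of_isPrimitiveRoot hp hξ)
  have hM : ∀ x : SeparableClosure F, x ^ 2 ∈ (algebraMap F (SeparableClosure F)).range →
      x ∈ doubleCyclicCompositum 2 F (SeparableClosure F) := fun x hx =>
    cyclicCompositum_le_doubleCyclicCompositum (mem_cyclicCompositum_of_pow hp hξ hx)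
  obtain ⟨τ, ⟨ι, hι, hτι⟩, hττ⟩ := exists_involution_of_isFormallyReal
    (Ω := SeparableClosure F) hξ h2 (exists_pow_eq_separableClosure hp hξ)
  obtain ⟨σ, hσ⟩ := exists_restriction
    (M := doubleCyclicCompositum 2 F (SeparableClosure F)) τ
  have hιF : ι ^ 2 ∈ (algebraMap F (SeparableClosure F)).range := ⟨-1, by simp [hι]⟩
  exact ⟨σ, (notMem_proPFrattini_iff hp hξ hM hσ).2 ⟨ι, hιF, hτι⟩,
    (orderOf_eq_iff_forall_mem hp hσ (hM ι hιF) hτι).2 hττ⟩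

/-- An element of order `p` of `V_F` outside the Frattini subgroup restricts to one of `W_F`. -/
theorem WGroup.exists_orderOf_eq (hp : p.Prime) {ξ : F} (hξ : IsPrimitiveRoot ξ p)
    {σ : VGroup p F} (hσ : σ ∉ proPFrattini p (VGroup p F)) (hord : orderOf σ = p) :
    ∃ ρ : WGroup p F, ρ ∉ proPFrattini p (WGroup p F) ∧ orderOf ρ = p := by
  have := normal_doubleCyclicCompositum (Ω := SeparableClosure F) hp hξ
  have := normal_galoisCyclicCompositum (F := F) (Ω := SeparableClosure F) (p := p)
  have hMW : ∀ x : SeparableClosure F, x ^ p ∈ (algebraMap F (SeparableClosure F)).range →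
      x ∈ galoisCyclicCompositum p F (SeparableClosure F) := fun x hx =>
    cyclicCompositum_le_galoisCyclicCompositum (mem_cyclicCompositum_of_pow hp hξ hx)
  have hle := galoisCyclicCompositum_le_doubleCyclicCompositum (F := F)
    (Ω := SeparableClosure F) (p := p)
  obtain ⟨τ, hτ⟩ := exists_lift (Ω := SeparableClosure F) σ
  obtain ⟨ρ, hρ⟩ := exists_restriction (M := galoisCyclicCompositum p F (SeparableClosure F)) τ
  obtain ⟨α, hα, hne⟩ :=
    (notMem_proPFrattini_iff hp hξ (fun x hx => hle (hMW x hx)) hτ).1 hσ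
  exact ⟨ρ, (notMem_proPFrattini_iff hp hξ hMW hρ).2 ⟨α, hα, hne⟩,
    (orderOf_eq_iff_forall_mem hp hρ (hMW α hα) hne).2 fun x hx =>
      (orderOf_eq_iff_forall_mem hp hτ (hle (hMW α hα)) hne).1 hord x (hle hx)⟩

theorem VGroup.orderOf_toT_le (hp : p.Prime) {σ : VGroup p F} (hord : orderOf σ = p)
    (E : IntermediateField F (SeparableClosure F)) [IsCyclicOfDegree p F E] :
    IsOfFinOrder (VGroup.toT hp E σ) ∧ orderOf (VGroup.toT hp E σ) ≤ p := by
  have h : (VGroup.toT hp E σ) ^ p = 1 := by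
    rw [← map_pow, orderOf_dvd_iff_pow_eq_one.1 (dvd_of_eq hord), map_one]
  -- Finite order is stated separately because `orderOf` takes the value `0` on elements of infinite
  -- order, for which the bound alone would hold.
  exact ⟨isOfFinOrder_iff_pow_eq_one.2 ⟨p, hp.pos, h⟩, orderOf_le_of_pow_eq_one hp.pos h⟩

/-- An ordering contains all sums of squares but not `-1`. -/
theorem IsFieldOrdering.isFormallyReal {P : Set F} (h : IsFieldOrdering P) : IsFormallyReal F := by
  by_contra hF
  obtain ⟨O, -, -⟩ := h
  exact O.neg_one_notMem (RingPreordering.mem_of_isSumSq (isSumSq_neg_one_of_not_isFormallyReal hF))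

end SeparableClosure

/-! ### The main theorem. -/

theorem mainTheorem7 {F : Type*} [Field F] {p : ℕ} (hp : p.Prime) (ξ : F)
    (hξ : IsPrimitiveRoot ξ p) :
    List.TFAE [
      ∃ σ : VGroup p F, σ ∉ proPFrattini p (VGroup p F) ∧ orderOf σ = p,
      ∃ σ : WGroup p F, σ ∉ proPFrattini p (WGroup p F) ∧ orderOf σ = p,
      ∃ σ : VGroup p F, σ ∉ proPFrattini p (VGroup p F) ∧
        ∀ (E : IntermediateField F (SeparableClosure F)) [IsCyclicOfDegree p F E],
          IsOfFinOrder (VGroup.toT hp E σ) ∧ orderOf (VGroup.toT hp E σ) ≤ p,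
      p = 2 ∧ IsFormallyReal F] ∧
    (∀ σ : VGroup p F, σ ∉ proPFrattini p (VGroup p F) → orderOf σ = p →
      IsFieldOrdering (fixedSquareRoots σ)) ∧
    (∀ σ : WGroup p F, σ ∉ proPFrattini p (WGroup p F) → orderOf σ = p →
      IsFieldOrdering (fixedSquareRoots σ)) ∧
    (∀ σ : VGroup p F, σ ∉ proPFrattini p (VGroup p F) →
      (∀ (E : IntermediateField F (SeparableClosure F)) [IsCyclicOfDegree p F E],
        IsOfFinOrder (VGroup.toT hp E σ) ∧ orderOf (VGroup.toT hp E σ) ≤ p) →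
      IsFieldOrdering (fixedSquareRoots σ)) := by
  -- Condition 1 is treated as a special case of condition 3, since homomorphic images of `σ` also
  -- have trivial `p`-th power.
  have h1 : ∀ σ : VGroup p F, σ ∉ proPFrattini p (VGroup p F) → orderOf σ = p →
      p = 2 ∧ IsFieldOrdering (fixedSquareRoots σ) := fun σ hσ hord =>
    VGroup.eq_two_and_isFieldOrdering hp hξ hσ fun E _ => VGroup.orderOf_toT_le hp hord E
  refine ⟨?_, fun σ hσ hord => (h1 σ hσ hord).2,
    fun σ hσ hord => (WGroup.eq_two_and_isFieldOrdering hp hξ hσ hord).2,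
    fun σ hσ hT => (VGroup.eq_two_and_isFieldOrdering hp hξ hσ hT).2⟩
  tfae_have 1 → 2 := fun ⟨σ, hσ, hord⟩ => WGroup.exists_orderOf_eq hp hξ hσ hord
  tfae_have 1 → 3 := fun ⟨σ, hσ, hord⟩ => ⟨σ, hσ, fun E _ => VGroup.orderOf_toT_le hp hord E⟩
  tfae_have 2 → 4 := fun ⟨σ, hσ, hord⟩ =>
    (WGroup.eq_two_and_isFieldOrdering hp hξ hσ hord).imp_right IsFieldOrdering.isFormallyReal
  tfae_have 3 → 4 := fun ⟨σ, hσ, hT⟩ =>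
    (VGroup.eq_two_and_isFieldOrdering hp hξ hσ hT).imp_right IsFieldOrdering.isFormallyReal
  tfae_have 4 → 1 := by
    rintro ⟨rfl, hF⟩
    exact VGroup.exists_orderOf_eq_two hξ
  tfae_finish
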